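/- Let $E$ be a real reflexive Banach space with separable dual, let $t_0\le T$, and let $(\Omega,\mathcal F,\{\mathcal F_t\}_{t\in[t_0,T]},\mathbb P)$ be a filtered probability space satisfying the usual conditions ($\mathcal F$ is complete, the filtration is right-continuous, and every $\mathcal F_t$ contains all $\mathbb P$-null sets). A set-valued map $X$ is called measurable with respect to a $\sigma$-algebra if $\{X\cap O\neq\emptyset\}$ belongs to it for every open $O\subseteq E$. Let $B=\{B_t\}_{t\in[t_0,T]}$ be a process whose values are non-empty closed subsets of $E$, such that $B_t$ is $\mathcal F_t$-measurable for every $t$ and $B_s\subseteq B_t$ for all $s<t$. Let $G=\{G_t\}_{t\in[t_0,T]}$ be a process whose values are closed convex subsets of $E$ containing $0$ and contained in one fixed closed bounded set $K\subseteq E$ (for all $\omega$ and $t$), such that $(\omega,t)\mapsto G_t(\omega)$ is measurable with respect to the predictable $\sigma$-algebra, which is generated by the sets $A\times\{t_0\}$ with $A\in\mathcal F_{t_0}$ and $A\times(s,t]$ with $A\in\mathcal F_s$, $(s,t]\subseteq[t_0,T]$. Write $A\oplus C=\overline{\{a+c:a\in A,\ c\in C\}}$ (so $\emptyset\oplus C=\emptyset$),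 and let $\int_a^b G(\tau)\,d\tau$ be the pathwise Aumann integral, i.e. the set of all Bochner integrals $\int_a^b g(\tau)\,d\tau$ of Lebesgue-integrable $g:[t_0,T]\to E$ with $g(\tau)\in G_\tau$ for a.e. $\tau$. For $t\in[t_0,T]$ and a partition $\Pi=\{t_0<t_1<\dots<t_n=t\}$ of $[t_0,t]$ put $\Delta B_{t_i}=B_{t_i}\setminus \operatorname{int}B_{t_{i-1}}$ and $$s_\Pi(t)=\Big(B_{t_0}\oplus\int_{t_0}^tG(\tau)\,d\tau\Big)\cup\bigcup_{i=1}^n\Big(\Delta B_{t_i}\oplus\int_{t_i}^tG(\tau)\,d\tau\Big),$$ $$S_\Pi(t)=\Big(B_{t_0}\oplus\int_{t_0}^tG(\tau)\,d\tau\Big)\cup\bigcup_{i=1}^n\Big(\Delta B_{t_i}\oplus\int_{t_{i-1}}^tG(\tau)\,d\tau\Big).$$ For every $t\in[t_0,T]$ let $\{\Pi^t_j\}_{j\in\mathbb N}$ be a sequence of partitions of $[t_0,t]$ whose mesh tends to $0$. A geometric random process (G-RaP) is a process $\Theta=\{\Theta_t\}_{t\in[t_0,T]}$ with non-empty closed values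 such that, almost surely, for all $t\in[t_0,T]$, $$\Theta_t=\overline{\bigcup_{j}s_{\Pi^t_j}(t)}=\lim_{j\to\infty}s_{\Pi^t_j}(t)=\lim_{j\to\infty}S_{\Pi^t_j}(t)=\bigcap_jS_{\Pi^t_j}(t),$$ where the limits are taken in the Hausdorff distance. Then a G-RaP exists, and every G-RaP $\Theta$ is non-decreasing with respect to set inclusion, that is, $$\mathbb P\big(\Theta_s\subseteq\Theta_t\ \text{ for all } t_0\le s<t\le T\big)=1,$$ and $\Theta$ is adapted to $\{\mathcal F_t\}_{t\in[t_0,T]}$, that is, $\Theta_t$ is $\mathcal F_t$-measurable for every $t\in[t_0,T]$. -/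

import Mathlib

open MeasureTheory Filter Topology
open scoped Pointwise ENNReal

namespace BirthGrowth

/-- A set-valued map `X` on `(Ω, m)` is measurable if it hits every open set on an event. -/
def SetMeasurable {Ω E : Type*} [TopologicalSpace E] (m : MeasurableSpace Ω)
    (X : Ω → Set E) : Prop :=
  ∀ O : Set E, IsOpen O → MeasurableSet[m] {ω | (X ω ∩ O).Nonempty}

/-- Measurable maps on `(Ω, m)` whose values are non-empty closed subsets of `E`. -/
structure IsRandomClosedSet {Ω E : Type*} [TopologicalSpace E] (m : MeasurableSpace Ω)
    (X : Ω → Set E) : Prop where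
  nonempty : ∀ ω, (X ω).Nonempty
  closed : ∀ ω, IsClosed (X ω)
  measurable : SetMeasurable m X

/-- `A ⊕ C`, the closure of the Minkowski sum. -/
def closedSum {E : Type*} [TopologicalSpace E] [Add E] (A C : Set E) : Set E :=
  closure (A + C)

/-- The integrable (a.e.) selections of a set-valued map. -/
def selections {α E : Type*} [MeasurableSpace α] [NormedAddCommGroup E]
    (X : α → Set E) (μ : Measure α) : Set (α → E) :=
  {x | Integrable x μ ∧ ∀ᵐ a ∂μ, x a ∈ X a}

/-- The Aumann integral of `X` over `A`: all Bochner integrals over `A` of integrable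
selections of `X`. -/
noncomputable def aumannIntegral {α E : Type*} [MeasurableSpace α] [NormedAddCommGroup E]
    [NormedSpace ℝ E] (X : α → Set E) (μ : Measure α) (A : Set α) : Set E :=
  {y | ∃ x ∈ selections X μ, y = ∫ a in A, x a ∂μ}

/-- Reflexivity of a normed space: the canonical map into the bidual is onto. -/
def IsReflexiveSpace (E : Type*) [NormedAddCommGroup E] [NormedSpace ℝ E] : Prop :=
  Function.Surjective (NormedSpace.inclusionInDoubleDual ℝ E)

/-- The usual conditions: right-continuity, and every subset of a null event belongs to every
`𝓕 t` (here `P A` is the outer measure of an arbitrary set `A`; in particular the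
probability space is complete). -/
structure UsualConditions {Ω ι : Type*} [PartialOrder ι] {m : MeasurableSpace Ω}
    (𝓕 : Filtration ι m) (P : Measure Ω) : Prop where
  rightContinuous : 𝓕.IsRightContinuous
  complete : ∀ (t : ι) (A : Set Ω), P A = 0 → MeasurableSet[𝓕 t] A

section Processes

variable {t₀ T : ℝ} {Ω E : Type*} {m : MeasurableSpace Ω}

/-- A nucleation process: adapted, with non-empty closed values, increasing in time. -/
structure IsNucleationProcess [TopologicalSpace E] (𝓕 : Filtration (Set.Icc t₀ T) m)
    (B : Set.Icc t₀ T → Ω → Set E) : Prop where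
  adapted : ∀ t, IsRandomClosedSet (𝓕 t) (B t)
  increasing : ∀ s t, s < t → ∀ ω, B s ω ⊆ B t ω

/-- A growth process: a predictable process of closed convex sets that contain the origin and
lie in one bounded closed set. -/
structure IsGrowthProcess [Fact (t₀ ≤ T)] [NormedAddCommGroup E] [NormedSpace ℝ E]
    (𝓕 : Filtration (Set.Icc t₀ T) m) (G : Set.Icc t₀ T → Ω → Set E) : Prop where
  closed : ∀ t ω, IsClosed (G t ω)
  zero_mem : ∀ t ω, (0 : E) ∈ G t ω
  convex : ∀ t ω, Convex ℝ (G t ω)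
  bounded : ∃ K : Set E, K.Nonempty ∧ IsClosed K ∧ Bornology.IsBounded K ∧ ∀ t ω, G t ω ⊆ K
  predictable : SetMeasurable 𝓕.predictable (fun p : Set.Icc t₀ T × Ω => G p.1 p.2)

/-- A partition `t₀ = pts 0 < pts 1 < ⋯ < pts n = t` of `[t₀, t]`, where `t ∈ [t₀, T]`. For
`t = t₀` it is the single point `t₀`, with `n = 0`. -/
structure TimePartition [Fact (t₀ ≤ T)] (t : Set.Icc t₀ T) where
  n : ℕ
  pts : Fin (n + 1) → Set.Icc t₀ T
  strictMono : StrictMono pts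
  first : pts 0 = ⊥
  last : pts (Fin.last n) = t

/-- The largest length of an interval of the partition (`0` if there is none). -/
noncomputable def TimePartition.mesh [Fact (t₀ ≤ T)] {t : Set.Icc t₀ T}
    (Q : TimePartition t) : ℝ :=
  ⨆ i : Fin Q.n, ((Q.pts i.succ : ℝ) - (Q.pts i.castSucc : ℝ))

/-- A sequence of partitions of `[t₀, t]` whose mesh tends to `0`. -/
def IsRefinementSequence [Fact (t₀ ≤ T)] {t : Set.Icc t₀ T} (Q : ℕ → TimePartition t) : Prop :=
  Tendsto (fun j => (Q j).mesh) atTop (𝓝 0)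

variable [Fact (t₀ ≤ T)] [NormedAddCommGroup E] [NormedSpace ℝ E]

/-- `∫_a^b G(ω, τ) dτ`, the Aumann integral for Lebesgue measure on `[t₀, T]`. -/
noncomputable def growthIntegral (G : Set.Icc t₀ T → Ω → Set E) (a b : Set.Icc t₀ T)
    (ω : Ω) : Set E :=
  aumannIntegral (fun τ => G τ ω) (Measure.comap Subtype.val volume) (Set.Icc a b)

/-- The nucleation increment `B_t ∖ interior B_s`. -/
def increment (B : Set.Icc t₀ T → Ω → Set E) (s t : Set.Icc t₀ T) (ω : Ω) : Set E :=
  B t ω \ interior (B s ω)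

/-- The lower sum of a partition of `[t₀, t]`. -/
noncomputable def lowerSum (B G : Set.Icc t₀ T → Ω → Set E) {t : Set.Icc t₀ T}
    (Q : TimePartition t) (ω : Ω) : Set E :=
  closedSum (B ⊥ ω) (growthIntegral G ⊥ t ω) ∪
    ⋃ i : Fin Q.n, closedSum (increment B (Q.pts i.castSucc) (Q.pts i.succ) ω)
      (growthIntegral G (Q.pts i.succ) t ω)

/-- The upper sum of a partition of `[t₀, t]`. -/
noncomputable def upperSum (B G : Set.Icc t₀ T → Ω → Set E) {t : Set.Icc t₀ T}
    (Q : TimePartition t) (ω : Ω) : Set E :=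
  closedSum (B ⊥ ω) (growthIntegral G ⊥ t ω) ∪
    ⋃ i : Fin Q.n, closedSum (increment B (Q.pts i.castSucc) (Q.pts i.succ) ω)
      (growthIntegral G (Q.pts i.castSucc) t ω)

/-- `A` is the common limit of the lower and upper sums of the partitions `Q 0, Q 1, …` at `ω`:
it is the closure of the union of the lower sums, the Hausdorff limit of the lower sums, the
Hausdorff limit of the upper sums, and the intersection of the upper sums. -/
structure IsCommonLimit (B G : Set.Icc t₀ T → Ω → Set E) {t : Set.Icc t₀ T}
    (Q : ℕ → TimePartition t) (ω : Ω) (A : Set E) : Prop where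
  closure_iUnion_lower : A = closure (⋃ j, lowerSum B G (Q j) ω)
  tendsto_lower :
    Tendsto (fun j => Metric.hausdorffEDist (lowerSum B G (Q j) ω) A) atTop (𝓝 0)
  tendsto_upper :
    Tendsto (fun j => Metric.hausdorffEDist (upperSum B G (Q j) ω) A) atTop (𝓝 0)
  iInter_upper : A = ⋂ j, upperSum B G (Q j) ω

/-- `Θ` is a geometric random process with nucleation `B` and growth `G`, formed along the
sequences of partitions `Q t` of `[t₀, t]`: a process with non-empty closed values such that,
almost surely, every `Θ t` is the common limit of the lower and upper sums. -/
structure IsGeometricRandomProcess (P : Measure Ω) (B G : Set.Icc t₀ T → Ω → Set E)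
    (Q : ∀ t : Set.Icc t₀ T, ℕ → TimePartition t) (Θ : Set.Icc t₀ T → Ω → Set E) : Prop where
  nonempty : ∀ t ω, (Θ t ω).Nonempty
  closed : ∀ t ω, IsClosed (Θ t ω)
  limit : ∀ᵐ ω ∂P, ∀ t, IsCommonLimit B G (Q t) ω (Θ t ω)

end Processes

end BirthGrowth

/-!
Fix `ω`. A point of `B r` belongs to `B ⊥` or enters `B` across some interval of a given
partition of `[t₀, t]`, and for `r ≤ t` that interval starts no later than `r`. As `0 ∈ G`, it
follows that `B r + ∫_r^s G` lies in every upper sum at every time `t ≥ s`. Hence every lower sum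
is contained in every upper sum, also at later times. The lower and upper sums of one partition
differ by integrals of `G` over single partition intervals, which are uniformly small for small
mesh by absolute continuity of the integral. The limits therefore exist, agree, and increase with
time.

For adaptedness, the limit at time `t` is the closure of a countable union of sets
`B r + ∫_r^t G`, and each of these has a Castaing representation: one adds measurable selections
of `B r` and integrals of predictable selections of `G`.
-/

namespace BirthGrowth

section HausdorffSandwich

variable {X ι : Type*} [PseudoEMetricSpace X]

lemma hausdorffEDist_le_of_subset_right {s t u : Set X} (hst : s ⊆ t) (htu : t ⊆ u) :
    Metric.hausdorffEDist s t ≤ Metric.hausdorffEDist s u := by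
  refine Metric.hausdorffEDist_le_of_infEDist (fun x hx => ?_) fun x hx => ?_
  · simp [Metric.infEDist_zero_of_mem (hst hx)]
  · rw [Metric.hausdorffEDist_comm]
    exact Metric.infEDist_le_hausdorffEDist_of_mem (htu hx)

lemma hausdorffEDist_le_of_subset_left {s t u : Set X} (hst : s ⊆ t) (htu : t ⊆ u) :
    Metric.hausdorffEDist u t ≤ Metric.hausdorffEDist s u := by
  refine Metric.hausdorffEDist_le_of_infEDist (fun x hx => ?_) fun x hx => ?_
  · rw [Metric.hausdorffEDist_comm]
    exact (Metric.infEDist_anti hst).trans (Metric.infEDist_le_hausdorffEDist_of_mem hx)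
  · simp [Metric.infEDist_zero_of_mem (htu hx)]

lemma closure_iUnion_eq_iInter {L U : ι → Set X} {l : Filter ι} [l.NeBot]
    (hLU : ∀ i j, L i ⊆ U j) (hU : ∀ j, IsClosed (U j))
    (hlim : Tendsto (fun j => Metric.hausdorffEDist (L j) (U j)) l (𝓝 0)) :
    closure (⋃ i, L i) = ⋂ j, U j := by
  refine Set.Subset.antisymm (closure_minimal (Set.iUnion_subset fun i =>
    Set.subset_iInter (hLU i)) (isClosed_iInter hU)) fun x hx => ?_
  rw [Metric.mem_closure_iff_infEDist_zero, ← nonpos_iff_eq_zero]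
  refine ge_of_tendsto' hlim fun j => ?_
  rw [Metric.hausdorffEDist_comm]
  exact (Metric.infEDist_anti (Set.subset_iUnion L j)).trans
    (Metric.infEDist_le_hausdorffEDist_of_mem (Set.mem_iInter.1 hx j))

end HausdorffSandwich

section SeparableDual

variable {𝕜 E : Type*} [RCLike 𝕜] [NormedAddCommGroup E] [NormedSpace 𝕜 E]

lemma exists_dual_ne_zero_of_topologicalClosure_ne_top {S : Submodule 𝕜 E}
    (hS : S.topologicalClosure ≠ ⊤) : ∃ f : StrongDual 𝕜 E, f ≠ 0 ∧ ∀ x ∈ S, f x = 0 := by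
  obtain ⟨z, -, hz⟩ := SetLike.exists_of_lt hS.lt_top
  have : IsClosed (S.topologicalClosure : Set E) := S.isClosed_topologicalClosure
  obtain ⟨f, hf⟩ : ∃ f : StrongDual 𝕜 (E ⧸ S.topologicalClosure), f (Submodule.Quotient.mk z) ≠ 0 :=
    SeparatingDual.exists_ne_zero (by rwa [Ne, Submodule.Quotient.mk_eq_zero])
  refine ⟨f.comp S.topologicalClosure.mkQL, fun h => hf (DFunLike.congr_fun h z), fun x hx => ?_⟩
  have hx0 : S.topologicalClosure.mkQL x = 0 :=
    (Submodule.Quotient.mk_eq_zero _).2 (S.le_topologicalClosure hx)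
  rw [ContinuousLinearMap.comp_apply, hx0, map_zero]

lemma exists_norm_le_one_half_norm_le (f : StrongDual 𝕜 E) :
    ∃ x : E, ‖x‖ ≤ 1 ∧ ‖f‖ / 2 ≤ ‖f x‖ := by
  rcases eq_or_ne f 0 with rfl | hf
  · exact ⟨0, by simp⟩
  · obtain ⟨x, hx, hfx⟩ := f.exists_lt_apply_of_lt_opNorm (half_lt_self (norm_pos_iff.2 hf))
    exact ⟨x, hx.le, hfx.le⟩

variable (𝕜 E) in
theorem separableSpace_of_separableSpace_dual [TopologicalSpace.SeparableSpace (StrongDual 𝕜 E)] :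
    TopologicalSpace.SeparableSpace E := by
  let c := TopologicalSpace.denseSeq (StrongDual 𝕜 E)
  choose x hx hcx using fun n => exists_norm_le_one_half_norm_le (c n)
  set S := Submodule.span 𝕜 (Set.range x)
  have hdense : S.topologicalClosure = ⊤ := by
    by_contra hS
    obtain ⟨f, hf, hfS⟩ := exists_dual_ne_zero_of_topologicalClosure_ne_top hS
    obtain ⟨n, hn⟩ := (TopologicalSpace.denseRange_denseSeq (StrongDual 𝕜 E)).exists_dist_lt f
      (show 0 < ‖f‖ / 4 by positivity)
    rw [dist_eq_norm, norm_sub_rev] at hn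
    have hcx_le : ‖c n (x n)‖ ≤ ‖c n - f‖ := by
      simpa [hfS _ (Submodule.subset_span ⟨n, rfl⟩)] using (c n - f).le_opNorm_of_le (hx n)
    have hf_le : ‖f‖ ≤ ‖c n - f‖ + ‖c n‖ := by
      simpa [norm_sub_rev] using norm_le_norm_sub_add f (c n)
    linarith [hcx n, norm_nonneg f]
  rw [← TopologicalSpace.isSeparable_univ_iff, ← Submodule.top_coe (R := 𝕜), ← hdense,
    Submodule.topologicalClosure_coe]
  exact (Set.countable_range x).isSeparable.span.closure

end SeparableDual

section MeasurableSelection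

variable {α E : Type*} {mα : MeasurableSpace α} [MetricSpace E]
  [TopologicalSpace.SeparableSpace E] [MeasurableSpace E] [BorelSpace E] {X : α → Set E}
  {h : α → E}

lemma IsRandomClosedSet.measurable_infDist (hX : IsRandomClosedSet mα X) (hh : Measurable h) :
    Measurable fun a => Metric.infDist (h a) (X a) := by
  have hpoint (x : E) : Measurable fun a => Metric.infDist x (X a) := by
    refine measurable_of_Iio fun r => ?_
    convert hX.measurable (Metric.ball x r) Metric.isOpen_ball using 1
    ext a
    simp [Metric.infDist_lt_iff (hX.nonempty a), Set.Nonempty, dist_comm x]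
  have huncurry : Measurable fun q : E × α => Metric.infDist q.1 (X q.2) :=
    measurable_uncurry_of_continuous_of_measurable (u := fun x a => Metric.infDist x (X a))
      (fun a => Metric.continuous_infDist_pt (X a)) hpoint
  have hcomp := huncurry.comp (hh.prodMk measurable_id)
  exact hcomp

lemma IsRandomClosedSet.exists_measurable_infDist_lt (hX : IsRandomClosedSet mα X)
    (hh : Measurable h) {δ : ℝ} (hδ : 0 < δ) :
    ∃ f : α → E, Measurable f ∧ ∀ a,
      dist (h a) (f a) < Metric.infDist (h a) (X a) + δ ∧ Metric.infDist (f a) (X a) < δ := by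
  classical
  rcases isEmpty_or_nonempty E with hE | hE
  · exact ⟨h, hh, fun a => hE.elim (h a)⟩
  let c := TopologicalSpace.denseSeq E
  let near (a : α) (n : ℕ) : Prop :=
    dist (h a) (c n) < Metric.infDist (h a) (X a) + δ ∧ Metric.infDist (c n) (X a) < δ
  have hnear (a : α) : ∃ n, near a n := by
    obtain ⟨y, hy, hhy⟩ := (Metric.infDist_lt_iff (hX.nonempty a)).1
      (lt_add_of_pos_right (Metric.infDist (h a) (X a)) hδ)
    have hopen : IsOpen {z | dist (h a) z < Metric.infDist (h a) (X a) + δ ∧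
        Metric.infDist z (X a) < δ} :=
      (isOpen_lt (continuous_const.dist continuous_id) continuous_const).inter
        (isOpen_lt (Metric.continuous_infDist_pt _) continuous_const)
    exact (TopologicalSpace.denseRange_denseSeq E).exists_mem_open hopen
      ⟨y, hhy, by rwa [Metric.infDist_zero_of_mem hy]⟩
  have hmeas (n : ℕ) : MeasurableSet {a | near a n} :=
    (measurableSet_lt (hh.dist measurable_const) ((hX.measurable_infDist hh).add_const δ)).inter
      (measurableSet_lt (hX.measurable_infDist measurable_const) measurable_const)
  exact ⟨fun a => c (Nat.find (hnear a)), (measurable_from_nat (f := c)).comp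
    (measurable_find hnear hmeas), fun a => Nat.find_spec (hnear a)⟩

lemma IsRandomClosedSet.exists_measurable_seq (hX : IsRandomClosedSet mα X) (hh : Measurable h)
    {δ : ℕ → ℝ} (hδ : ∀ n, 0 < δ n) :
    ∃ u : ℕ → α → E, (∀ n, Measurable (u n)) ∧
      (∀ a, dist (h a) (u 0 a) < Metric.infDist (h a) (X a) + δ 0) ∧
      (∀ n a, Metric.infDist (u n a) (X a) < δ n) ∧
      ∀ n a, dist (u n a) (u (n + 1) a) < δ n + δ (n + 1) := by
  choose! next hnext_meas hnext using fun (n : ℕ) (g : α → E) (hg : Measurable g) =>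
    hX.exists_measurable_infDist_lt hg (hδ n)
  let u : ℕ → α → E := Nat.rec (next 0 h) fun n g => next (n + 1) g
  have hu (n : ℕ) : Measurable (u n) := by
    induction n with
    | zero => exact hnext_meas 0 h hh
    | succ n ih => exact hnext_meas (n + 1) _ ih
  have hclose (n : ℕ) (a : α) : Metric.infDist (u n a) (X a) < δ n := by
    cases n with
    | zero => exact (hnext 0 h hh a).2
    | succ n => exact (hnext (n + 1) _ (hu n) a).2
  exact ⟨u, hu, fun a => (hnext 0 h hh a).1, hclose, fun n a =>
    (hnext (n + 1) _ (hu n) a).1.trans (add_lt_add_left (hclose n a) _)⟩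

/-- A quantitative form of the Kuratowski–Ryll-Nardzewski selection theorem. -/
theorem IsRandomClosedSet.exists_measurable_selection_dist_le [CompleteSpace E]
    (hX : IsRandomClosedSet mα X) (hh : Measurable h) {ε : ℝ} (hε : 0 < ε) :
    ∃ f : α → E, Measurable f ∧ (∀ a, f a ∈ X a) ∧
      ∀ a, dist (h a) (f a) ≤ Metric.infDist (h a) (X a) + ε := by
  let δ (n : ℕ) : ℝ := ε / 8 * (1 / 2) ^ n
  have hδ (n : ℕ) : 0 < δ n := by positivity
  have hδ_lim : Tendsto δ atTop (𝓝 0) := by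
    simpa [δ] using (tendsto_pow_atTop_nhds_zero_of_lt_one (r := (1 / 2 : ℝ)) (by norm_num)
      (by norm_num)).const_mul (ε / 8)
  obtain ⟨u, hu, hu_zero, hu_close, hu_succ⟩ := hX.exists_measurable_seq hh hδ
  have hu_geom (a : α) (n : ℕ) : dist (u n a) (u (n + 1) a) ≤ ε / 4 * (1 / 2) ^ n := by
    have hsum : δ n + δ (n + 1) = 3 / 4 * (ε / 4 * (1 / 2) ^ n) := by simp only [δ]; ring
    have hpos : 0 < ε / 4 * (1 / 2 : ℝ) ^ n := by positivity
    linarith [hu_succ n a]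
  choose f hf using fun a => cauchySeq_tendsto_of_complete
    (cauchySeq_of_le_geometric _ _ (by norm_num) (hu_geom a))
  refine ⟨f, measurable_of_tendsto_metrizable hu (tendsto_pi_nhds.2 hf), fun a => ?_, fun a => ?_⟩
  · rw [(hX.closed a).mem_iff_infDist_zero (hX.nonempty a)]
    exact le_antisymm (le_of_tendsto_of_tendsto'
      (((Metric.continuous_infDist_pt (X a)).tendsto _).comp (hf a)) hδ_lim
      fun n => (hu_close n a).le) Metric.infDist_nonneg
  · have hlim : dist (u 0 a) (f a) ≤ ε / 2 :=
      (dist_le_of_le_geometric_of_tendsto₀ _ _ (by norm_num) (hu_geom a) (hf a)).trans_eq (by ring)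
    have hδ_zero : δ 0 = ε / 8 := by simp [δ]
    linarith [dist_triangle (h a) (u 0 a) (f a), hu_zero a]

end MeasurableSelection

section CastaingRepresentation

variable {α E ι κ : Type*} {m : MeasurableSpace α}

/-- A Castaing representation of a set-valued map `X`: measurable selections whose values at
each point are dense in the value of `X`. -/
structure IsCastaingRepresentation [TopologicalSpace E] [MeasurableSpace E]
    (m : MeasurableSpace α) (X : α → Set E) (x : ι → α → E) : Prop where
  measurable : ∀ i, Measurable[m] (x i)
  mem : ∀ i a, x i a ∈ X a
  subset_closure : ∀ a, X a ⊆ closure (Set.range fun i => x i a)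

lemma IsCastaingRepresentation.mono [TopologicalSpace E] [MeasurableSpace E]
    {m' : MeasurableSpace α} (hm : m ≤ m') {X : α → Set E} {x : ι → α → E}
    (hx : IsCastaingRepresentation m X x) : IsCastaingRepresentation m' X x :=
  ⟨fun i => (hx.measurable i).mono hm le_rfl, hx.mem, hx.subset_closure⟩

lemma IsCastaingRepresentation.setMeasurable [TopologicalSpace E] [MeasurableSpace E]
    [OpensMeasurableSpace E] [Countable ι] {X : α → Set E} {x : ι → α → E}
    (hx : IsCastaingRepresentation m X x) : SetMeasurable m X := by
  intro O hO
  have hpreimage : {a | (X a ∩ O).Nonempty} = ⋃ i, x i ⁻¹' O := by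
    ext a
    rw [Set.mem_iUnion]
    constructor
    · rintro ⟨y, hyX, hyO⟩
      obtain ⟨_, hO', i, rfl⟩ := mem_closure_iff.1 (hx.subset_closure a hyX) O hO hyO
      exact ⟨i, hO'⟩
    · rintro ⟨i, hi⟩
      exact ⟨x i a, hx.mem i a, hi⟩
  rw [hpreimage]
  exact MeasurableSet.iUnion fun i => hx.measurable i hO.measurableSet

lemma IsCastaingRepresentation.add [TopologicalSpace E] [MeasurableSpace E] [Add E]
    [ContinuousAdd E] [MeasurableAdd₂ E] {X Y : α → Set E} {x : ι → α → E} {y : κ → α → E}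
    (hx : IsCastaingRepresentation m X x) (hy : IsCastaingRepresentation m Y y) :
    IsCastaingRepresentation m (fun a => X a + Y a) fun (k : ι × κ) a => x k.1 a + y k.2 a where
  measurable k := (hx.measurable k.1).add (hy.measurable k.2)
  mem k a := Set.add_mem_add (hx.mem k.1 a) (hy.mem k.2 a)
  subset_closure a := by
    rintro _ ⟨u, hu, v, hv, rfl⟩
    refine map_mem_closure₂ continuous_add (hx.subset_closure a hu) (hy.subset_closure a hv) ?_
    rintro _ ⟨i, rfl⟩ _ ⟨j, rfl⟩
    exact ⟨(i, j), rfl⟩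

theorem IsRandomClosedSet.exists_isCastaingRepresentation [MetricSpace E] [CompleteSpace E]
    [TopologicalSpace.SeparableSpace E] [MeasurableSpace E] [BorelSpace E] {X : α → Set E}
    (hX : IsRandomClosedSet m X) : ∃ x : ℕ × ℕ → α → E, IsCastaingRepresentation m X x := by
  rcases isEmpty_or_nonempty E with hE | hE
  · have : IsEmpty α := ⟨fun a => hE.elim (hX.nonempty a).some⟩
    exact ⟨fun _ => isEmptyElim, fun _ => measurable_of_empty _, fun _ => isEmptyElim,
      isEmptyElim⟩
  let c := TopologicalSpace.denseSeq E
  choose x hx_meas hx_mem hx_dist using fun i : ℕ × ℕ =>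
    hX.exists_measurable_selection_dist_le (measurable_const (a := c i.1))
      (Nat.one_div_pos_of_nat (n := i.2) (α := ℝ))
  refine ⟨x, hx_meas, hx_mem, fun a y hy => Metric.mem_closure_range_iff.2 fun ε hε => ?_⟩
  obtain ⟨k, hk⟩ := (TopologicalSpace.denseRange_denseSeq E).exists_dist_lt y
    (show 0 < ε / 4 by positivity)
  obtain ⟨n, hn⟩ := exists_nat_one_div_lt (show 0 < ε / 4 by positivity)
  have hinf : Metric.infDist (c k) (X a) ≤ dist y (c k) :=
    dist_comm y (c k) ▸ Metric.infDist_le_dist_of_mem hy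
  exact ⟨(k, n), by linarith [hx_dist (k, n) a, dist_triangle y (c k) (x (k, n) a)]⟩

end CastaingRepresentation

section SetMeasurable

variable {Ω E : Type*} [TopologicalSpace E] {m : MeasurableSpace Ω}

lemma SetMeasurable.closure_iUnion {ι : Type*} [Countable ι] {X : ι → Ω → Set E}
    (hX : ∀ i, SetMeasurable m (X i)) : SetMeasurable m fun ω => closure (⋃ i, X i ω) := by
  intro O hO
  simp only [closure_inter_open_nonempty_iff hO, Set.iUnion_inter, Set.nonempty_iUnion,
    Set.ofPred_exists]
  exact MeasurableSet.iUnion fun i => hX i O hO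

lemma SetMeasurable.congr_ae {m' : MeasurableSpace Ω} {P : Measure[m'] Ω}
    (hm : ∀ A, P A = 0 → MeasurableSet[m] A) {X Y : Ω → Set E} (hX : SetMeasurable m X)
    (hXY : ∀ᵐ ω ∂P, X ω = Y ω) : SetMeasurable m Y := by
  intro O hO
  let N := {ω | X ω ≠ Y ω}
  have hN (A : Set Ω) (hA : A ⊆ N) : MeasurableSet[m] A :=
    hm A (measure_mono_null hA (ae_iff.1 hXY))
  have hset : {ω | (Y ω ∩ O).Nonempty} =
      {ω | (X ω ∩ O).Nonempty} \ N ∪ {ω | (Y ω ∩ O).Nonempty} ∩ N := by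
    ext ω
    by_cases h : X ω = Y ω <;> simp [N, h]
  rw [hset]
  exact ((hX O hO).diff (hN N subset_rfl)).union (hN _ Set.inter_subset_right)

end SetMeasurable

section AumannIntegral

variable {α E : Type*} [MeasurableSpace α] {μ : Measure α} [NormedAddCommGroup E] {X : α → Set E}

/-- Integrable boundedness of a set-valued map: almost everywhere, its values lie in balls
around the origin whose radius is an integrable function. -/
def IsIntegrablyBounded (X : α → Set E) (μ : Measure α) : Prop :=
  ∃ φ : α → ℝ, Integrable φ μ ∧ ∀ᵐ a ∂μ, ∀ y ∈ X a, ‖y‖ ≤ φ a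

lemma IsIntegrablyBounded.integrable (hX : IsIntegrablyBounded X μ) {x : α → E}
    (hx : AEStronglyMeasurable x μ) (hxX : ∀ᵐ a ∂μ, x a ∈ X a) : Integrable x μ := by
  obtain ⟨φ, hφ, hXφ⟩ := hX
  exact hφ.mono' hx (by filter_upwards [hXφ, hxX] with a ha hxa using ha _ hxa)

lemma isIntegrablyBounded_of_isBounded [IsFiniteMeasure μ] {K : Set E}
    (hK : Bornology.IsBounded K) (hX : ∀ a, X a ⊆ K) : IsIntegrablyBounded X μ := by
  obtain ⟨M, hM⟩ := hK.exists_norm_le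
  exact ⟨fun _ => M, integrable_const M, ae_of_all _ fun a y hy => hM y (hX a hy)⟩

variable [NormedSpace ℝ E]

lemma zero_mem_aumannIntegral (h0 : ∀ᵐ a ∂μ, 0 ∈ X a) (s : Set α) : 0 ∈ aumannIntegral X μ s :=
  ⟨0, ⟨integrable_zero _ _ _, h0⟩, by simp⟩

lemma aumannIntegral_mono (h0 : ∀ᵐ a ∂μ, 0 ∈ X a) {s t : Set α} (hs : MeasurableSet s)
    (hst : s ⊆ t) : aumannIntegral X μ s ⊆ aumannIntegral X μ t := by
  rintro _ ⟨x, ⟨hx, hxX⟩, rfl⟩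
  refine ⟨s.indicator x, ⟨hx.indicator hs, ?_⟩, ?_⟩
  · filter_upwards [h0, hxX] with a h0a hxa
    by_cases ha : a ∈ s <;> simpa [ha]
  · rw [setIntegral_indicator hs, Set.inter_eq_right.2 hst]

lemma exists_mem_aumannIntegral_edist_le {φ : α → ℝ} (hφ : ∀ᵐ a ∂μ, ∀ y ∈ X a, ‖y‖ ≤ φ a)
    {s t : Set α} (hs : MeasurableSet s) (hst : s ⊆ t) {y : E} (hy : y ∈ aumannIntegral X μ t) :
    ∃ y' ∈ aumannIntegral X μ s, edist y y' ≤ ∫⁻ a in t \ s, ‖φ a‖ₑ ∂μ := by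
  obtain ⟨x, ⟨hx, hxX⟩, rfl⟩ := hy
  refine ⟨_, ⟨x, ⟨hx, hxX⟩, rfl⟩, ?_⟩
  rw [edist_eq_enorm_sub, ← setIntegral_sdiff hs hx.integrableOn hst]
  refine (enorm_integral_le_lintegral_enorm _).trans (lintegral_mono_ae (ae_restrict_of_ae ?_))
  filter_upwards [hφ, hxX] with a hφa hxa
  exact enorm_le_iff_norm_le.2 ((hφa _ hxa).trans (le_abs_self _))

end AumannIntegral

section DenseSelections

variable {α Ω E : Type*} [MeasurableSpace α] {μ : Measure α} [NormedAddCommGroup E]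
  [TopologicalSpace.SeparableSpace E]

variable (E μ) in
lemma exists_seq_stronglyMeasurable_dense_integrable [MeasureTheory.IsSeparable μ] :
    ∃ c : ℕ → α → E, (∀ k, StronglyMeasurable (c k)) ∧
      ∀ g, Integrable g μ → ∀ ε > 0, ∃ k, ∫⁻ a, edist (g a) (c k a) ∂μ < ε := by
  have : Fact ((1 : ℝ≥0∞) ≠ ∞) := ⟨ENNReal.one_ne_top⟩
  let c := TopologicalSpace.denseSeq (Lp E 1 μ)
  refine ⟨fun k => c k, fun k => Lp.stronglyMeasurable (c k), fun g hg ε hε => ?_⟩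
  obtain ⟨_, ⟨k, rfl⟩, hk⟩ := EMetric.mem_closure_iff.1
    (TopologicalSpace.denseRange_denseSeq (Lp E 1 μ) (hg.toL1 g)) ε hε
  have hck : Integrable (c k) μ := L1.integrable_coeFn (c k)
  exact ⟨k, (hg.edist_toL1_toL1 g (c k) hck).symm.trans_lt (by rwa [hck.toL1_coeFn])⟩

/-- The selections are chosen nearly closest to an `L¹`-dense sequence of deterministic functions,
so that their distance to `g` is at most about twice that of the deterministic function. -/
theorem IsRandomClosedSet.exists_seq_measurable_dense_selections [CompleteSpace E]
    [MeasurableSpace E] [BorelSpace E] [IsFiniteMeasure μ] [MeasureTheory.IsSeparable μ]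
    {mp : MeasurableSpace (α × Ω)} (hfst : Measurable[mp] (Prod.fst : α × Ω → α))
    {X : α × Ω → Set E} (hX : IsRandomClosedSet mp X) :
    ∃ p : ℕ × ℕ → α × Ω → E, (∀ i, Measurable[mp] (p i)) ∧ (∀ i q, p i q ∈ X q) ∧
      ∀ ω, ∀ g ∈ selections (fun a => X (a, ω)) μ, ∀ ε > 0,
        ∃ i, ∫⁻ a, edist (g a) (p i (a, ω)) ∂μ < ε := by
  obtain ⟨c, hc_meas, hc_dense⟩ := exists_seq_stronglyMeasurable_dense_integrable E μ
  have hc (k : ℕ) : Measurable[mp] fun q : α × Ω => c k q.1 := (hc_meas k).measurable.comp hfst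
  choose p hp_meas hp_mem hp_dist using fun i : ℕ × ℕ =>
    hX.exists_measurable_selection_dist_le (hc i.1) (Nat.one_div_pos_of_nat (n := i.2) (α := ℝ))
  refine ⟨p, hp_meas, hp_mem, ?_⟩
  rintro ω g ⟨hg, hgX⟩ ε hε
  have hpoint (k n : ℕ) : ∀ᵐ a ∂μ, edist (g a) (p (k, n) (a, ω)) ≤
      2 * edist (g a) (c k a) + ENNReal.ofReal (1 / ((n : ℝ) + 1)) := by
    filter_upwards [hgX] with a ha
    have hinf : Metric.infDist (c k a) (X (a, ω)) ≤ dist (g a) (c k a) :=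
      dist_comm (g a) (c k a) ▸ Metric.infDist_le_dist_of_mem ha
    have hdist : dist (c k a) (p (k, n) (a, ω)) ≤
        Metric.infDist (c k a) (X (a, ω)) + 1 / (n + 1) := hp_dist (k, n) (a, ω)
    simp only [edist_dist]
    rw [← ENNReal.ofReal_ofNat 2, ← ENNReal.ofReal_mul zero_le_two,
      ← ENNReal.ofReal_add (by positivity) (by positivity)]
    exact ENNReal.ofReal_le_ofReal
      (by linarith [dist_triangle (g a) (c k a) (p (k, n) (a, ω))])
  have hintegral (k n : ℕ) : ∫⁻ a, edist (g a) (p (k, n) (a, ω)) ∂μ ≤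
      2 * ∫⁻ a, edist (g a) (c k a) ∂μ + ENNReal.ofReal (1 / ((n : ℝ) + 1)) * μ Set.univ := by
    refine (lintegral_mono_ae (hpoint k n)).trans_eq ?_
    rw [lintegral_add_right _ measurable_const, lintegral_const_mul' _ _ ENNReal.ofNat_ne_top,
      lintegral_const]
  obtain ⟨k, hk⟩ := hc_dense g hg (ε / 2) (by simpa using hε.ne')
  have hlim : Tendsto (fun n : ℕ => 2 * ∫⁻ a, edist (g a) (c k a) ∂μ +
      ENNReal.ofReal (1 / ((n : ℝ) + 1)) * μ Set.univ) atTop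
      (𝓝 (2 * ∫⁻ a, edist (g a) (c k a) ∂μ + ENNReal.ofReal 0 * μ Set.univ)) :=
    tendsto_const_nhds.add (ENNReal.Tendsto.mul_const
      (ENNReal.tendsto_ofReal tendsto_one_div_add_atTop_nhds_zero_nat)
      (Or.inr (measure_ne_top μ Set.univ)))
  rw [ENNReal.ofReal_zero, zero_mul, add_zero] at hlim
  obtain ⟨n, hn⟩ := (hlim.eventually_lt_const (ENNReal.mul_lt_of_lt_div' hk)).exists
  exact ⟨(k, n), (hintegral k n).trans_lt hn⟩

end DenseSelections

section Predictable

variable {ι Ω E : Type*} {m : MeasurableSpace Ω} [LinearOrder ι] [TopologicalSpace ι]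
  [OrderTopology ι] [MeasurableSpace ι] [BorelSpace ι] {𝓕 : Filtration ι m}
  [NormedAddCommGroup E] [NormedSpace ℝ E]

lemma stronglyMeasurable_setIntegral_of_isStronglyProgressive {u : ι → Ω → E}
    (hu : IsStronglyProgressive 𝓕 u) (μ : Measure ι) [IsFiniteMeasure μ] {t : ι} {s : Set ι}
    (hst : s ⊆ Set.Iic t) : StronglyMeasurable[𝓕 t] fun ω => ∫ τ in s, u τ ω ∂μ := by
  let _ : MeasurableSpace Ω := 𝓕 t
  have hsubtype (ω : Ω) : ∫ τ in s, u τ ω ∂μ =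
      ∫ τ : Set.Iic t, u τ ω ∂(μ.restrict s).comap Subtype.val := by
    rw [integral_subtype_comap measurableSet_Iic fun τ => u τ ω,
      Measure.restrict_restrict measurableSet_Iic, Set.inter_eq_right.2 hst]
  simp only [hsubtype]
  exact (hu t).integral_prod_left'

variable [OrderBot ι]

lemma measurable_fst_predictable [SecondCountableTopology ι] :
    Measurable[𝓕.predictable] (Prod.fst : ι × Ω → ι) := by
  refine measurable_of_Ioi fun i => ?_
  simpa only [Set.prod_univ] using
    measurableSet_predictable_Ioi_prod (𝓕 := 𝓕) (i := i) MeasurableSet.univ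

lemma measurable_prodMk_predictable (ω : Ω) :
    Measurable[_, 𝓕.predictable] fun i : ι => (i, ω) := by
  refine measurable_generateFrom ?_
  rintro _ (⟨A, -, rfl⟩ | ⟨i, A, -, rfl⟩) <;> by_cases hω : ω ∈ A <;> simp [hω]

variable [CompleteSpace E] [TopologicalSpace.SeparableSpace E] [MeasurableSpace E] [BorelSpace E]

theorem IsRandomClosedSet.exists_isCastaingRepresentation_aumannIntegral
    [SecondCountableTopology ι] {G : ι → Ω → Set E}
    (hG : IsRandomClosedSet 𝓕.predictable fun p : ι × Ω => G p.1 p.2) {μ : Measure ι}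
    [IsFiniteMeasure μ] (hGb : ∀ ω, IsIntegrablyBounded (fun τ => G τ ω) μ) {t : ι} {s : Set ι}
    (hst : s ⊆ Set.Iic t) :
    ∃ y : ℕ × ℕ → Ω → E,
      IsCastaingRepresentation (𝓕 t) (fun ω => aumannIntegral (fun τ => G τ ω) μ s) y := by
  have := UniformSpace.secondCountable_of_separable E
  obtain ⟨p, hp_meas, hp_mem, hp_dense⟩ :=
    hG.exists_seq_measurable_dense_selections (μ := μ) measurable_fst_predictable
  have hp_progressive (i : ℕ × ℕ) : IsStronglyProgressive 𝓕 fun τ ω => p i (τ, ω) :=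
    IsStronglyPredictable.isStronglyProgressive (hp_meas i).stronglyMeasurable
  have hp_int (i : ℕ × ℕ) (ω : Ω) : Integrable (fun τ => p i (τ, ω)) μ :=
    (hGb ω).integrable ((hp_meas i).comp (measurable_prodMk_predictable ω)).aestronglyMeasurable
      (ae_of_all _ fun τ => hp_mem i (τ, ω))
  refine ⟨fun i ω => ∫ τ in s, p i (τ, ω) ∂μ, fun i =>
    (stronglyMeasurable_setIntegral_of_isStronglyProgressive (hp_progressive i) μ hst).measurable,
    fun i ω => ⟨_, ⟨hp_int i ω, ae_of_all _ fun τ => hp_mem i (τ, ω)⟩, rfl⟩, ?_⟩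
  rintro ω _ ⟨g, hg, rfl⟩
  refine EMetric.mem_closure_iff.2 fun ε hε => ?_
  obtain ⟨i, hi⟩ := hp_dense ω g hg ε hε
  refine ⟨_, ⟨i, rfl⟩, lt_of_le_of_lt ?_ hi⟩
  exact (edist_integral_le_lintegral_edist hg.1.integrableOn (hp_int i ω).integrableOn).trans
    (setLIntegral_le_lintegral s _)

end Predictable

section TimePartition

variable {t₀ T : ℝ}

variable (t₀ T) in
/-- Lebesgue measure on the time interval `[t₀, T]`, the measure of `growthIntegral`. -/
noncomputable abbrev timeMeasure : Measure (Set.Icc t₀ T) :=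
  Measure.comap Subtype.val volume

instance : IsFiniteMeasure (timeMeasure t₀ T) :=
  have := IsFiniteMeasureOnCompacts.comap' (volume : Measure ℝ)
    (continuous_subtype_val (p := (· ∈ Set.Icc t₀ T))) (.subtype_coe measurableSet_Icc)
  CompactSpace.isFiniteMeasure

lemma timeMeasure_Ico (a b : Set.Icc t₀ T) :
    timeMeasure t₀ T (Set.Ico a b) = ENNReal.ofReal (b - a) := by
  rw [(MeasurableEmbedding.subtype_coe measurableSet_Icc).comap_apply,
    Set.image_subtype_val_Ico, Real.volume_Ico]

variable [Fact (t₀ ≤ T)] {t : Set.Icc t₀ T}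

lemma TimePartition.pts_le (Q : TimePartition t) (k : Fin (Q.n + 1)) : Q.pts k ≤ t :=
  (Q.strictMono.monotone (Fin.le_last k)).trans_eq Q.last

lemma TimePartition.sub_le_mesh (Q : TimePartition t) (i : Fin Q.n) :
    (Q.pts i.succ : ℝ) - Q.pts i.castSucc ≤ Q.mesh :=
  le_ciSup (f := fun i : Fin Q.n => (Q.pts i.succ : ℝ) - Q.pts i.castSucc)
    (Set.finite_range _).bddAbove i

lemma TimePartition.mem_bot_or_exists_mem_sdiff (Q : TimePartition t) {E : Type*}
    {S : Set.Icc t₀ T → Set E} {x : E} (hx : x ∈ S t) :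
    x ∈ S ⊥ ∨ ∃ i : Fin Q.n, x ∈ S (Q.pts i.succ) \ S (Q.pts i.castSucc) := by
  by_contra! h
  have hnot (k : Fin (Q.n + 1)) : x ∉ S (Q.pts k) := by
    induction k using Fin.induction with
    | zero => simpa only [Q.first] using h.1
    | succ i ih => exact fun hi => h.2 i ⟨hi, ih⟩
  exact hnot (Fin.last Q.n) (by simpa only [Q.last] using hx)

/-- The largest integral of `f` over an interval of the partition: a version of `mesh` for the
measure with density `f`. -/
noncomputable def TimePartition.lintegralMesh (Q : TimePartition t) (f : Set.Icc t₀ T → ℝ≥0∞) :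
    ℝ≥0∞ :=
  ⨆ i : Fin Q.n, ∫⁻ τ in Set.Ico (Q.pts i.castSucc) (Q.pts i.succ), f τ ∂timeMeasure t₀ T

lemma IsRefinementSequence.tendsto_lintegralMesh {Q : ℕ → TimePartition t}
    (hQ : IsRefinementSequence Q) {f : Set.Icc t₀ T → ℝ≥0∞}
    (hf : ∫⁻ τ, f τ ∂timeMeasure t₀ T ≠ ∞) :
    Tendsto (fun j => (Q j).lintegralMesh f) atTop (𝓝 0) := by
  refine ENNReal.tendsto_nhds_zero.2 fun ε hε => ?_
  obtain ⟨δ, hδ, hfδ⟩ := exists_pos_setLIntegral_lt_of_measure_lt hf hε.ne'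
  have hmesh : Tendsto (fun j => ENNReal.ofReal (Q j).mesh) atTop (𝓝 0) := by
    simpa using ENNReal.tendsto_ofReal hQ
  filter_upwards [hmesh.eventually_lt_const hδ] with j hj
  refine iSup_le fun i => (hfδ _ ?_).le
  rw [timeMeasure_Ico]
  exact (ENNReal.ofReal_le_ofReal ((Q j).sub_le_mesh i)).trans_lt hj

end TimePartition

section Pathwise

variable {t₀ T : ℝ} [Fact (t₀ ≤ T)] {Ω E : Type*} [NormedAddCommGroup E] [NormedSpace ℝ E]
  {B G : Set.Icc t₀ T → Ω → Set E} {ω : Ω} {s t : Set.Icc t₀ T}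

lemma isClosed_upperSum (Q : TimePartition t) : IsClosed (upperSum B G Q ω) :=
  isClosed_closure.union (isClosed_iUnion_of_finite fun _ => isClosed_closure)

lemma lowerSum_subset_iUnion (Q : TimePartition t) :
    lowerSum B G Q ω ⊆ ⋃ k, closure (B (Q.pts k) ω + growthIntegral G (Q.pts k) t ω) := by
  refine Set.union_subset (Set.subset_iUnion_of_subset 0 ?_) (Set.iUnion_subset fun i => ?_)
  · rw [Q.first, closedSum]
  · exact Set.subset_iUnion_of_subset i.succ
      (closure_mono (Set.add_subset_add_right Set.sdiff_subset))

lemma lowerSum_nonempty (hB : (B ⊥ ω).Nonempty) (hG0 : ∀ᵐ τ ∂timeMeasure t₀ T, 0 ∈ G τ ω)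
    (Q : TimePartition t) : (lowerSum B G Q ω).Nonempty :=
  (hB.add ⟨0, zero_mem_aumannIntegral hG0 _⟩).closure.inl

lemma infEDist_lowerSum_le {φ : Set.Icc t₀ T → ℝ}
    (hφ : ∀ᵐ τ ∂timeMeasure t₀ T, ∀ y ∈ G τ ω, ‖y‖ ≤ φ τ) (Q : TimePartition t) {x : E}
    (hx : x ∈ upperSum B G Q ω) :
    Metric.infEDist x (lowerSum B G Q ω) ≤ Q.lintegralMesh fun τ => ‖φ τ‖ₑ := by
  rcases hx with hx | hx
  · have hx_lower : x ∈ lowerSum B G Q ω := Or.inl hx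
    simp [Metric.infEDist_zero_of_mem hx_lower]
  obtain ⟨i, hi⟩ := Set.mem_iUnion.1 hx
  have hclosed : IsClosed {z : E | Metric.infEDist z (lowerSum B G Q ω) ≤
      Q.lintegralMesh fun τ => ‖φ τ‖ₑ} := isClosed_Iic.preimage Metric.continuous_infEDist
  refine closure_minimal ?_ hclosed hi
  rintro _ ⟨b, hb, y, hy, rfl⟩
  obtain ⟨y', hy', hyy'⟩ := exists_mem_aumannIntegral_edist_le hφ measurableSet_Icc
    (Set.Icc_subset_Icc_left (Q.strictMono.monotone i.castSucc_lt_succ.le)) hy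
  have hlower : b + y' ∈ lowerSum B G Q ω :=
    Or.inr (Set.mem_iUnion.2 ⟨i, subset_closure (Set.add_mem_add hb hy')⟩)
  have hgap : Set.Icc (Q.pts i.castSucc) t \ Set.Icc (Q.pts i.succ) t ⊆
      Set.Ico (Q.pts i.castSucc) (Q.pts i.succ) :=
    fun τ hτ => ⟨hτ.1.1, not_le.1 fun h => hτ.2 ⟨h, hτ.1.2⟩⟩
  calc Metric.infEDist (b + y) (lowerSum B G Q ω)
      ≤ edist (b + y) (b + y') := Metric.infEDist_le_edist_of_mem hlower
    _ = edist y y' := edist_add_left b y y'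
    _ ≤ _ := hyy'.trans (lintegral_mono_set hgap)
    _ ≤ Q.lintegralMesh fun τ => ‖φ τ‖ₑ :=
      le_iSup (fun i : Fin Q.n => ∫⁻ τ in Set.Ico (Q.pts i.castSucc) (Q.pts i.succ),
        ‖φ τ‖ₑ ∂timeMeasure t₀ T) i

variable (hB : Monotone fun τ => B τ ω) (hG0 : ∀ᵐ τ ∂timeMeasure t₀ T, 0 ∈ G τ ω)
include hB hG0

lemma add_growthIntegral_subset_upperSum {r : Set.Icc t₀ T} (hrt : r ≤ t) (hst : s ≤ t)
    (Q : TimePartition t) : B r ω + growthIntegral G r s ω ⊆ upperSum B G Q ω := by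
  rintro _ ⟨x, hx, y, hy, rfl⟩
  have hy_mem {a : Set.Icc t₀ T} (har : a ≤ r) : y ∈ growthIntegral G a t ω :=
    aumannIntegral_mono hG0 measurableSet_Icc (Set.Icc_subset_Icc har hst) hy
  rcases Q.mem_bot_or_exists_mem_sdiff (S := fun τ => B τ ω) (hB hrt hx) with hx_bot | ⟨i, hi⟩
  · exact Or.inl (subset_closure (Set.add_mem_add hx_bot (hy_mem bot_le)))
  · have hir : Q.pts i.castSucc ≤ r := not_lt.1 fun h => hi.2 (hB h.le hx)
    exact Or.inr (Set.mem_iUnion.2 ⟨i, subset_closure (Set.add_mem_add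
      ⟨hi.1, fun h => hi.2 (interior_subset h)⟩ (hy_mem hir))⟩)

lemma lowerSum_subset_upperSum (hst : s ≤ t) (Q : TimePartition s) (Q' : TimePartition t) :
    lowerSum B G Q ω ⊆ upperSum B G Q' ω :=
  (lowerSum_subset_iUnion Q).trans <| Set.iUnion_subset fun k =>
    closure_minimal (add_growthIntegral_subset_upperSum hB hG0 ((Q.pts_le k).trans hst) hst Q')
      (isClosed_upperSum Q')

lemma tendsto_hausdorffEDist_lowerSum_upperSum
    (hGb : IsIntegrablyBounded (fun τ => G τ ω) (timeMeasure t₀ T)) {Q : ℕ → TimePartition t}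
    (hQ : IsRefinementSequence Q) :
    Tendsto (fun j => Metric.hausdorffEDist (lowerSum B G (Q j) ω) (upperSum B G (Q j) ω))
      atTop (𝓝 0) := by
  obtain ⟨φ, hφ_int, hφ⟩ := hGb
  refine tendsto_of_tendsto_of_tendsto_of_le_of_le tendsto_const_nhds
    (hQ.tendsto_lintegralMesh (f := fun τ => ‖φ τ‖ₑ) hφ_int.2.ne) (fun _ => zero_le) fun j => ?_
  refine Metric.hausdorffEDist_le_of_infEDist (fun x hx => ?_) fun x hx =>
    infEDist_lowerSum_le hφ (Q j) hx
  simp [Metric.infEDist_zero_of_mem (lowerSum_subset_upperSum hB hG0 le_rfl (Q j) (Q j) hx)]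

theorem isCommonLimit_closure_iUnion_lowerSum
    (hGb : IsIntegrablyBounded (fun τ => G τ ω) (timeMeasure t₀ T)) {Q : ℕ → TimePartition t}
    (hQ : IsRefinementSequence Q) :
    IsCommonLimit B G Q ω (closure (⋃ j, lowerSum B G (Q j) ω)) := by
  have hlim := tendsto_hausdorffEDist_lowerSum_upperSum hB hG0 hGb hQ
  have heq := closure_iUnion_eq_iInter
    (fun i j => lowerSum_subset_upperSum hB hG0 le_rfl (Q i) (Q j))
    (fun j => isClosed_upperSum (Q j)) hlim
  have hlower (j : ℕ) : lowerSum B G (Q j) ω ⊆ closure (⋃ j, lowerSum B G (Q j) ω) :=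
    (Set.subset_iUnion (fun j => lowerSum B G (Q j) ω) j).trans subset_closure
  have hupper (j : ℕ) : closure (⋃ j, lowerSum B G (Q j) ω) ⊆ upperSum B G (Q j) ω :=
    heq.trans_subset (Set.iInter_subset _ j)
  exact ⟨rfl,
    tendsto_of_tendsto_of_tendsto_of_le_of_le tendsto_const_nhds hlim (fun _ => zero_le)
      fun j => hausdorffEDist_le_of_subset_right (hlower j) (hupper j),
    tendsto_of_tendsto_of_tendsto_of_le_of_le tendsto_const_nhds hlim (fun _ => zero_le)
      fun j => hausdorffEDist_le_of_subset_left (hlower j) (hupper j), heq⟩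

lemma IsCommonLimit.subset (hst : s ≤ t) {Q : ℕ → TimePartition s} {Q' : ℕ → TimePartition t}
    {A A' : Set E} (hA : IsCommonLimit B G Q ω A) (hA' : IsCommonLimit B G Q' ω A') :
    A ⊆ A' := by
  rw [hA.closure_iUnion_lower, hA'.iInter_upper]
  exact closure_minimal (Set.iUnion_subset fun i => Set.subset_iInter fun j =>
    lowerSum_subset_upperSum hB hG0 hst (Q i) (Q' j))
    (isClosed_iInter fun j => isClosed_upperSum (Q' j))

lemma IsCommonLimit.eq_closure_iUnion {Q : ℕ → TimePartition t} {A : Set E}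
    (hA : IsCommonLimit B G Q ω A) :
    A = closure (⋃ (j) (k), B ((Q j).pts k) ω + growthIntegral G ((Q j).pts k) t ω) := by
  refine Set.Subset.antisymm ?_ (closure_minimal ?_ ?_)
  · rw [hA.closure_iUnion_lower]
    refine closure_minimal (Set.iUnion_subset fun j => ?_) isClosed_closure
    refine (lowerSum_subset_iUnion (Q j)).trans (Set.iUnion_subset fun k => closure_mono ?_)
    exact Set.subset_iUnion₂ (s := fun j k =>
      B ((Q j).pts k) ω + growthIntegral G ((Q j).pts k) t ω) j k
  · rw [hA.iInter_upper]
    exact Set.iUnion₂_subset fun j k => Set.subset_iInter fun i =>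
      add_growthIntegral_subset_upperSum hB hG0 ((Q j).pts_le k) le_rfl (Q i)
  · rw [hA.closure_iUnion_lower]
    exact isClosed_closure

end Pathwise

section GeometricRandomProcess

variable {t₀ T : ℝ} {Ω E : Type*} {m : MeasurableSpace Ω} {𝓕 : Filtration (Set.Icc t₀ T) m}
  {B G : Set.Icc t₀ T → Ω → Set E}

lemma IsNucleationProcess.monotone [TopologicalSpace E] (hB : IsNucleationProcess 𝓕 B) (ω : Ω) :
    Monotone fun t => B t ω :=
  monotone_iff_forall_lt.2 fun s t hst => hB.increasing s t hst ω

variable [Fact (t₀ ≤ T)] [NormedAddCommGroup E] [NormedSpace ℝ E]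

lemma IsGrowthProcess.isRandomClosedSet (hG : IsGrowthProcess 𝓕 G) :
    IsRandomClosedSet 𝓕.predictable fun p : Set.Icc t₀ T × Ω => G p.1 p.2 :=
  ⟨fun p => ⟨0, hG.zero_mem p.1 p.2⟩, fun p => hG.closed p.1 p.2, hG.predictable⟩

lemma IsGrowthProcess.isIntegrablyBounded (hG : IsGrowthProcess 𝓕 G) (ω : Ω) :
    IsIntegrablyBounded (fun τ => G τ ω) (timeMeasure t₀ T) :=
  have ⟨_, _, _, hK, hGK⟩ := hG.bounded
  isIntegrablyBounded_of_isBounded hK fun τ => hGK τ ω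

variable {P : Measure Ω} {Q : ∀ t : Set.Icc t₀ T, ℕ → TimePartition t}
  {Θ : Set.Icc t₀ T → Ω → Set E}

variable (P) in
theorem isGeometricRandomProcess_closure_iUnion_lowerSum (hB0 : ∀ ω, (B ⊥ ω).Nonempty)
    (hB : ∀ ω, Monotone fun t => B t ω) (hG0 : ∀ ω, ∀ᵐ τ ∂timeMeasure t₀ T, 0 ∈ G τ ω)
    (hGb : ∀ ω, IsIntegrablyBounded (fun τ => G τ ω) (timeMeasure t₀ T))
    (hQ : ∀ t, IsRefinementSequence (Q t)) :
    IsGeometricRandomProcess P B G Q fun t ω => closure (⋃ j, lowerSum B G (Q t j) ω) where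
  nonempty t ω := (Set.nonempty_iUnion.2 ⟨0, lowerSum_nonempty (hB0 ω) (hG0 ω) (Q t 0)⟩).closure
  closed _ _ := isClosed_closure
  limit := ae_of_all _ fun ω t =>
    isCommonLimit_closure_iUnion_lowerSum (hB ω) (hG0 ω) (hGb ω) (hQ t)

theorem IsGeometricRandomProcess.ae_monotone (hΘ : IsGeometricRandomProcess P B G Q Θ)
    (hB : ∀ ω, Monotone fun t => B t ω) (hG0 : ∀ ω, ∀ᵐ τ ∂timeMeasure t₀ T, 0 ∈ G τ ω) :
    ∀ᵐ ω ∂P, Monotone fun t => Θ t ω := by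
  filter_upwards [hΘ.limit] with ω hω s t hst
  exact (hω s).subset (hB ω) (hG0 ω) hst (hω t)

variable [CompleteSpace E] [TopologicalSpace.SeparableSpace E]

lemma setMeasurable_add_growthIntegral {r t : Set.Icc t₀ T} (hrt : r ≤ t)
    (hB : IsRandomClosedSet (𝓕 r) (B r))
    (hG : IsRandomClosedSet 𝓕.predictable fun p : Set.Icc t₀ T × Ω => G p.1 p.2)
    (hGb : ∀ ω, IsIntegrablyBounded (fun τ => G τ ω) (timeMeasure t₀ T)) :
    SetMeasurable (𝓕 t) fun ω => B r ω + growthIntegral G r t ω := by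
  borelize E
  have := UniformSpace.secondCountable_of_separable E
  obtain ⟨x, hx⟩ := hB.exists_isCastaingRepresentation
  obtain ⟨y, hy⟩ := hG.exists_isCastaingRepresentation_aumannIntegral hGb
    (Set.Icc_subset_Iic_self (a := r) (b := t))
  exact ((hx.mono (𝓕.mono hrt)).add hy).setMeasurable

theorem IsGeometricRandomProcess.isRandomClosedSet (hΘ : IsGeometricRandomProcess P B G Q Θ)
    (h𝓕 : ∀ t A, P A = 0 → MeasurableSet[𝓕 t] A) (hB : IsNucleationProcess 𝓕 B)
    (hG : IsRandomClosedSet 𝓕.predictable fun p : Set.Icc t₀ T × Ω => G p.1 p.2)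
    (hG0 : ∀ ω, ∀ᵐ τ ∂timeMeasure t₀ T, 0 ∈ G τ ω)
    (hGb : ∀ ω, IsIntegrablyBounded (fun τ => G τ ω) (timeMeasure t₀ T)) (t : Set.Icc t₀ T) :
    IsRandomClosedSet (𝓕 t) (Θ t) := by
  have hunion : SetMeasurable (𝓕 t) fun ω => closure (⋃ q : Σ j, Fin ((Q t j).n + 1),
      B ((Q t q.1).pts q.2) ω + growthIntegral G ((Q t q.1).pts q.2) t ω) :=
    SetMeasurable.closure_iUnion fun q =>
      setMeasurable_add_growthIntegral ((Q t q.1).pts_le q.2) (hB.adapted _) hG hGb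
  refine ⟨hΘ.nonempty t, hΘ.closed t, hunion.congr_ae (h𝓕 t) ?_⟩
  filter_upwards [hΘ.limit] with ω hω
  rw [(hω t).eq_closure_iUnion (hB.monotone ω) (hG0 ω), Set.iUnion_sigma]

end GeometricRandomProcess

end BirthGrowth

theorem mainTheorem1_general {E : Type*} [NormedAddCommGroup E] [NormedSpace ℝ E]
    [CompleteSpace E] [TopologicalSpace.SeparableSpace E] {t₀ T : ℝ} [Fact (t₀ ≤ T)]
    {Ω : Type*} {m : MeasurableSpace Ω} (P : Measure Ω) (𝓕 : Filtration (Set.Icc t₀ T) m)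
    (h𝓕 : ∀ t A, P A = 0 → MeasurableSet[𝓕 t] A) (B G : Set.Icc t₀ T → Ω → Set E)
    (hB : BirthGrowth.IsNucleationProcess 𝓕 B)
    (hG : BirthGrowth.IsRandomClosedSet 𝓕.predictable fun p : Set.Icc t₀ T × Ω => G p.1 p.2)
    (hG0 : ∀ ω, ∀ᵐ τ ∂BirthGrowth.timeMeasure t₀ T, 0 ∈ G τ ω)
    (hGb : ∀ ω, BirthGrowth.IsIntegrablyBounded (fun τ => G τ ω) (BirthGrowth.timeMeasure t₀ T))
    (Q : ∀ t : Set.Icc t₀ T, ℕ → BirthGrowth.TimePartition t)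
    (hQ : ∀ t, BirthGrowth.IsRefinementSequence (Q t)) :
    (∃ Θ : Set.Icc t₀ T → Ω → Set E, BirthGrowth.IsGeometricRandomProcess P B G Q Θ) ∧
    ∀ Θ : Set.Icc t₀ T → Ω → Set E, BirthGrowth.IsGeometricRandomProcess P B G Q Θ →
      (∀ᵐ ω ∂P, ∀ s t, s < t → Θ s ω ⊆ Θ t ω) ∧
      (∀ t, BirthGrowth.IsRandomClosedSet (𝓕 t) (Θ t)) := by
  refine ⟨⟨_, BirthGrowth.isGeometricRandomProcess_closure_iUnion_lowerSum P
    (hB.adapted ⊥).nonempty hB.monotone hG0 hGb hQ⟩, fun Θ hΘ => ⟨?_, ?_⟩⟩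
  · filter_upwards [hΘ.ae_monotone hB.monotone hG0] with ω hω s t hst using hω hst.le
  · exact hΘ.isRandomClosedSet h𝓕 hB hG hG0 hGb

theorem mainTheorem1 {E : Type*} [NormedAddCommGroup E] [NormedSpace ℝ E] [CompleteSpace E]
    (hrefl : BirthGrowth.IsReflexiveSpace E)
    [TopologicalSpace.SeparableSpace (StrongDual ℝ E)]
    {t₀ T : ℝ} [Fact (t₀ ≤ T)]
    {Ω : Type*} {m : MeasurableSpace Ω} (P : MeasureTheory.Measure Ω)
    [MeasureTheory.IsProbabilityMeasure P]
    (𝓕 : MeasureTheory.Filtration (Set.Icc t₀ T) m) (h𝓕 : BirthGrowth.UsualConditions 𝓕 P)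
    (B G : Set.Icc t₀ T → Ω → Set E)
    (hB : BirthGrowth.IsNucleationProcess 𝓕 B) (hG : BirthGrowth.IsGrowthProcess 𝓕 G)
    (Q : ∀ t : Set.Icc t₀ T, ℕ → BirthGrowth.TimePartition t)
    (hQ : ∀ t, BirthGrowth.IsRefinementSequence (Q t)) :
    (∃ Θ : Set.Icc t₀ T → Ω → Set E, BirthGrowth.IsGeometricRandomProcess P B G Q Θ) ∧
    ∀ Θ : Set.Icc t₀ T → Ω → Set E, BirthGrowth.IsGeometricRandomProcess P B G Q Θ →
      (∀ᵐ ω ∂P, ∀ s t, s < t → Θ s ω ⊆ Θ t ω) ∧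
      (∀ t, BirthGrowth.IsRandomClosedSet (𝓕 t) (Θ t)) := by
  have := BirthGrowth.separableSpace_of_separableSpace_dual ℝ E
  exact mainTheorem1_general P 𝓕 h𝓕.complete B G hB hG.isRandomClosedSet
    (fun ω => ae_of_all _ fun τ => hG.zero_mem τ ω) hG.isIntegrablyBounded Q hQ
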